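/- Let $\Omega\subseteq\mathbb C^n$ be a domain (a non-empty connected open set), let $H=H(K)\subseteq\mathcal O(\Omega)$ be a Hilbert space of analytic functions on $\Omega$ with continuous point evaluations and reproducing kernel $K:\Omega\times\Omega\to\mathbb C$, and let $D$ be a finite-dimensional complex Hilbert space. Let $H(K_D)\subseteq\mathcal O(\Omega,D)$ be the functional Hilbert space of $D$-valued functions with the operator-valued reproducing kernel $K_D(z,w)=K(z,w)1_D$ (it can be identified with $H(K)\otimes D$), and let $M(H)=\{\varphi:\Omega\to\mathbb C;\ \varphi H\subseteq H\}$ be the multiplier algebra of $H$. For a linear subspace $M\subseteq H(K_D)$, its fiber dimension is $$\mathrm{fd}(M)=\max_{z\in\Omega}\dim M_z,\qquad M_z=\{f(z);\ f\in M\}\subseteq D .$$ $M(H)$ is called dense in $M$ if every $f\in M$ is the pointwise limit on $\Omega$ of a sequence of functions in $M$ whose coordinate functions with respect to some (equivalently, every) basis of $D$ belong to $M(H)$. For closed subspaces $M_1,M_2$ let $M_1\vee M_2$ denote the closed linear span of $M_1\cup M_2$. Suppose that $H$ contains all constant functions and that the coordinate functions $z_1,\dots,z_n$ belong to $M(H)$.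 (a) For any pair of closed subspaces $M_1,M_2\subseteq H(K_D)$ such that $M(H)M_i\subseteq M_i$ for $i=1,2$ and such that $M(H)$ is dense in $M_1$ and in $M_2$, the fiber dimension formula $$\mathrm{fd}(M_1\vee M_2)+\mathrm{fd}(M_1\cap M_2)=\mathrm{fd}(M_1)+\mathrm{fd}(M_2)$$ holds. (b) If in addition $K$ is a complete Nevanlinna-Pick kernel, that is, $K$ has no zeros and the mapping $1-\frac1K$ is positive definite (all its finite Gram matrices are positive semidefinite), then the fiber dimension formula holds for all closed subspaces $M_1,M_2\subseteq H(K_D)$ which are invariant for $M(H)$. -/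

import Mathlib

namespace FiberDim

section Scalar

variable {n : ℕ} {Ω : Set (Fin n → ℂ)}

/-- A function on `Ω ⊆ ℂⁿ` is analytic if it is the restriction of a map that has a convergent
power series expansion at each point of `Ω` (for open `Ω` the values outside `Ω` play no role). -/
def IsAnalyticOn (f : Ω → ℂ) : Prop :=
  ∃ F : (Fin n → ℂ) → ℂ, AnalyticOnNhd ℂ F Ω ∧ ∀ z : Ω, F z = f z

variable (H : Type*) [NormedAddCommGroup H] [InnerProductSpace ℂ H] [RKHS ℂ H Ω ℂ]

/-- The multiplier algebra `M(H) = {φ : Ω → ℂ | φ H ⊆ H}` of a functional Hilbert space `H`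
on `Ω`. -/
def multiplierAlgebra : Subalgebra ℂ (Ω → ℂ) where
  carrier := {φ | ∀ f : H, ∃ g : H, ∀ z : Ω, g z = φ z * f z}
  mul_mem' := by
    intro φ ψ hφ hψ f
    obtain ⟨g, hg⟩ := hψ f
    obtain ⟨h, hh⟩ := hφ g
    exact ⟨h, fun z => by rw [hh, hg, Pi.mul_apply, mul_assoc]⟩
  add_mem' := by
    intro φ ψ hφ hψ f
    obtain ⟨g, hg⟩ := hφ f
    obtain ⟨h, hh⟩ := hψ f
    exact ⟨g + h, fun z => by simp [hg, hh, add_mul]⟩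
  algebraMap_mem' := by
    intro c f
    exact ⟨c • f, fun z => by simp⟩

variable [CompleteSpace H]

/-- The reproducing kernel `K : Ω × Ω → ℂ` of a scalar functional Hilbert space, that is,
`K(z, w) = K_w(z)` where `⟪K_w, f⟫ = f(w)` for all `f`. -/
noncomputable def scalarKernel (z w : Ω) : ℂ := RKHS.kernel H z w 1

/-- The operator-valued kernel `K_D(z, w) = K(z, w) 1_D`. -/
noncomputable def kernelD (D : Type*) [NormedAddCommGroup D] [InnerProductSpace ℂ D] :
    Matrix Ω Ω (D →L[ℂ] D) :=
  Matrix.of fun z w => scalarKernel H z w • ContinuousLinearMap.id ℂ D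

end Scalar

open scoped ComplexOrder in
/-- `K` is a complete Nevanlinna-Pick kernel: `K` has no zeros and `1 - 1/K` is positive definite
in the sense of kernels, i.e. all its finite Gram matrices are positive semidefinite. -/
def IsCompleteNevanlinnaPick {X : Type*} (K : X → X → ℂ) : Prop :=
  (∀ z w, K z w ≠ 0) ∧ (Matrix.of fun z w => 1 - 1 / K z w : Matrix X X ℂ).PosSemidef

section Vector

variable {X : Type*} {D : Type*} [NormedAddCommGroup D] [InnerProductSpace ℂ D]
variable {E : Type*} [NormedAddCommGroup E] [InnerProductSpace ℂ E] [RKHS ℂ E X D]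

/-- The fiber `M_z = {f(z) | f ∈ M} ⊆ D` of a space `M` of `D`-valued functions. -/
noncomputable def fiber (M : Submodule ℂ E) (z : X) : Submodule ℂ D :=
  M.map ((LinearMap.proj z).comp (RKHS.coeCLM ℂ : E →L[ℂ] X → D).toLinearMap)

/-- The fiber dimension `fd(M) = max_z dim M_z`. For finite-dimensional `D` the dimensions are
bounded by `dim D`, so the supremum in `ℕ` is a maximum. -/
noncomputable def fd (M : Submodule ℂ E) : ℕ :=
  ⨆ z : X, Module.finrank ℂ (fiber M z)

/-- `A M ⊆ M`. -/
def IsInvariant (A : Subalgebra ℂ (X → ℂ)) (M : Submodule ℂ E) : Prop :=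
  ∀ φ ∈ A, ∀ f ∈ M, ∃ g ∈ M, ∀ z : X, g z = φ z • f z

/-- The coordinate functions of `f` with respect to some (equivalently, every) basis of the
finite-dimensional space `D` belong to `A`. -/
def HasCoeffsIn (A : Subalgebra ℂ (X → ℂ)) (f : X → D) : Prop :=
  ∃ b : Module.Basis (Fin (Module.finrank ℂ D)) ℂ D, ∀ i, (fun z => b.repr (f z) i) ∈ A

/-- `A` is dense in `M`: every `f ∈ M` is the pointwise limit of a sequence of functions in `M`
with coefficients in `A`. -/
def IsDenseIn (A : Subalgebra ℂ (X → ℂ)) (M : Submodule ℂ E) : Prop :=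
  ∀ f ∈ M, ∃ u : ℕ → E, (∀ k, u k ∈ M ∧ HasCoeffsIn A (u k)) ∧
    ∀ z : X, Filter.Tendsto (fun k => u k z) Filter.atTop (nhds (f z))

/-- The fiber dimension formula for `M₁` and `M₂`, where `M₁ ∨ M₂` is the closed linear span. -/
def FiberDimensionFormula (M₁ M₂ : Submodule ℂ E) : Prop :=
  fd (M₁ ⊔ M₂).topologicalClosure + fd (M₁ ⊓ M₂) = fd M₁ + fd M₂

end Vector

end FiberDim

/-! At a point z where the four fibers in question all have maximal dimension, the formula becomes
dim(V + W) + dim(V ∩ W) = dim V + dim W for V, W the fibers of M₁, M₂. Such z exist: each fiber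
dimension is maximal off the zeros of a nonzero analytic determinant, and a product of nonzero
analytic functions on a domain is nonzero. The fiber of M₁ ∨ M₂ is V + W because evaluations are
continuous.

The substance is that M₁ ∩ M₂ has fiber V ∩ W (`fiber_inf_fiber_le`). Given q in M₂ with multiplier
coefficients and q(z) in V, Cramer's rule expresses a multiple of q through elements of M₁ and M₂
with multiplier coefficients. Moving the M₂ part to the other side leaves an element of M₁ ∩ M₂ with
value q(z) at z.

It remains to span the fibers by functions with multiplier coefficients. In (a) this follows from
density, as subspaces of D are closed. In (b), let P be the projection onto M and k_w the kernel
functions. Both P k_w / K(·, w) and the difference of K_D and the kernel of M are positive, which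
makes the coordinates of P k_w d / K(·, w) multipliers; these functions span the fiber at w. -/

namespace FiberDim

universe u

open scoped InnerProductSpace ComplexOrder ComplexConjugate

/-! ### Membership in a reproducing kernel space by duality. -/

section Criterion

variable {X V E : Type*} [NormedAddCommGroup V] [InnerProductSpace ℂ V] [CompleteSpace V]
  [NormedAddCommGroup E] [InnerProductSpace ℂ E] [CompleteSpace E] [RKHS ℂ E X V]

/-- A function belongs to a reproducing kernel Hilbert space as soon as the functional it induces
on finite combinations of kernel functions is bounded. -/
theorem exists_of_norm_sum_inner_le (g : X → V) {C : ℝ} (hC : 0 ≤ C)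
    (h : ∀ (s : Finset X) (v : X → V),
      ‖∑ x ∈ s, ⟪g x, v x⟫_ℂ‖ ≤ C * ‖∑ x ∈ s, RKHS.kerFun E x (v x)‖) :
    ∃ f : E, (∀ x, f x = g x) ∧ ‖f‖ ≤ C := by
  let T : (X →₀ V) →ₗ[ℂ] E := Finsupp.lsum ℂ fun x => (RKHS.kerFun E x).toLinearMap
  let l : (X →₀ V) →ₗ[ℂ] ℂ := Finsupp.lsum ℂ fun x => (innerSL ℂ (g x)).toLinearMap
  have hl : ∀ v, ‖l v‖ ≤ C * ‖T v‖ := fun v => by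
    simpa [T, l, Finsupp.sum] using h v.support v
  -- The bound lets `l` descend to the range of `T`. Hahn-Banach extends it to `E`, and its Riesz
  -- vector is the function sought.
  have hker : T.ker ≤ l.ker := fun v hv => by
    have := hl v
    rw [LinearMap.mem_ker] at hv ⊢
    simpa [hv] using this
  let φ : T.range →ₗ[ℂ] ℂ := (T.ker.liftQ l hker) ∘ₗ T.quotKerEquivRange.symm.toLinearMap
  have hφ : ∀ v, φ ⟨T v, LinearMap.mem_range_self T v⟩ = l v := fun v => by
    simp [φ, LinearMap.quotKerEquivRange_symm_apply_image]
  let Φ : StrongDual ℂ T.range := φ.mkContinuous C (by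
    rintro ⟨_, v, rfl⟩
    rw [hφ]
    exact hl v)
  obtain ⟨Ψ, hΨ, hnorm⟩ := exists_extension_norm_eq T.range Φ
  refine ⟨(InnerProductSpace.toDual ℂ E).symm Ψ, fun x => ?_, ?_⟩
  · refine ext_inner_right ℂ fun v => ?_
    rw [← RKHS.inner_kerFun, InnerProductSpace.toDual_symm_apply]
    have h1 : T (Finsupp.single x v) = RKHS.kerFun E x v := by simp [T]
    have h2 := hΨ ⟨T (Finsupp.single x v), LinearMap.mem_range_self T _⟩
    have h3 := hφ (Finsupp.single x v)
    have h4 : l (Finsupp.single x v) = ⟪g x, v⟫_ℂ := by simp [l]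
    rw [← h4, ← h3, ← h1]
    exact h2
  · rw [LinearIsometryEquiv.norm_map, hnorm]
    exact LinearMap.mkContinuous_norm_le _ hC _

/-- If the adjoint of multiplication by the row `b` is contractive on kernel functions, then the
row multiplies `E ^ ι` contractively into `E`. -/
theorem exists_row_mul {ι : Type*} [Fintype ι] (b : ι → X → ℂ)
    (h : ∀ (s : Finset X) (v : X → V),
      ∑ i, ‖∑ x ∈ s, conj (b i x) • RKHS.kerFun E x (v x)‖ ^ 2 ≤
        ‖∑ x ∈ s, RKHS.kerFun E x (v x)‖ ^ 2) (y : ι → E) :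
    ∃ g : E, (∀ x, g x = ∑ i, b i x • y i x) ∧ ‖g‖ ≤ √(∑ i, ‖y i‖ ^ 2) := by
  refine exists_of_norm_sum_inner_le _ (Real.sqrt_nonneg _) fun s v => ?_
  have key : ∑ x ∈ s, ⟪∑ i, b i x • y i x, v x⟫_ℂ =
      ∑ i, ⟪y i, ∑ x ∈ s, conj (b i x) • RKHS.kerFun E x (v x)⟫_ℂ := by
    simp only [sum_inner, inner_sum, inner_smul_left, inner_smul_right, RKHS.inner_kerFun]
    exact Finset.sum_comm
  rw [key]
  calc _ ≤ ∑ i, ‖y i‖ * ‖∑ x ∈ s, conj (b i x) • RKHS.kerFun E x (v x)‖ :=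
        (norm_sum_le _ _).trans (Finset.sum_le_sum fun i _ => norm_inner_le_norm _ _)
    _ ≤ √(∑ i, ‖y i‖ ^ 2) *
        √(∑ i, ‖∑ x ∈ s, conj (b i x) • RKHS.kerFun E x (v x)‖ ^ 2) :=
        Real.sum_mul_le_sqrt_mul_sqrt _ _ _
    _ ≤ _ := by
        gcongr
        exact Real.sqrt_le_iff.2 ⟨norm_nonneg _, h s v⟩

end Criterion

/-! ### Positive semidefinite kernels. -/

section PosSemidef

variable {X : Type u}

theorem posSemidef_sum_nonneg {M : Matrix X X ℂ} (hM : M.PosSemidef) (s : Finset X) (c : X → ℂ) :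
    0 ≤ ∑ x ∈ s, ∑ y ∈ s, conj (c x) * M x y * c y := by
  classical
  have h := (hM.submatrix (Subtype.val : s → X)).dotProduct_mulVec_nonneg fun x => c x
  simp only [dotProduct, Matrix.mulVec, Matrix.submatrix_apply, Pi.star_apply, Finset.mul_sum,
    RCLike.star_def] at h
  rw [← Finset.sum_coe_sort]
  refine h.trans_eq (Finset.sum_congr rfl fun x _ => ?_)
  rw [← Finset.sum_coe_sort s]
  exact Finset.sum_congr rfl fun y _ => by ring

theorem posSemidef_of_sum_nonneg {M : Matrix X X ℂ} (h : M.IsHermitian)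
    (h' : ∀ (s : Finset X) (c : X → ℂ), 0 ≤ ∑ x ∈ s, ∑ y ∈ s, conj (c x) * M x y * c y) :
    M.PosSemidef :=
  ⟨h, fun c => by simpa [Finsupp.sum] using h' c.support c⟩

theorem sum_conj_mul_inner_mul {F : Type*} [NormedAddCommGroup F] [InnerProductSpace ℂ F]
    (u : X → F) (s : Finset X) (c : X → ℂ) :
    ∑ x ∈ s, ∑ y ∈ s, conj (c x) * ⟪u x, u y⟫_ℂ * c y = (‖∑ x ∈ s, c x • u x‖ ^ 2 : ℝ) := by
  rw [Complex.ofReal_pow, ← Complex.coe_algebraMap, ← inner_self_eq_norm_sq_to_K (𝕜 := ℂ)]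
  rw [sum_inner]
  refine Finset.sum_congr rfl fun x _ => ?_
  rw [inner_sum]
  refine Finset.sum_congr rfl fun y _ => ?_
  rw [inner_smul_left, inner_smul_right]
  ring

theorem posSemidef_inner {F : Type*} [NormedAddCommGroup F] [InnerProductSpace ℂ F] (u : X → F) :
    (Matrix.of fun x y => ⟪u x, u y⟫_ℂ).PosSemidef := by
  refine posSemidef_of_sum_nonneg (Matrix.IsHermitian.ext fun x y => inner_conj_symm _ _)
    fun s c => ?_
  simp only [Matrix.of_apply, sum_conj_mul_inner_mul]
  exact Complex.zero_le_real.2 (sq_nonneg _)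

/-- Moore's theorem: every positive semidefinite scalar kernel has a feature map. -/
theorem exists_feature_map {S : Matrix X X ℂ} (hS : S.PosSemidef) :
    ∃ (F : Type u) (_ : NormedAddCommGroup F) (_ : InnerProductSpace ℂ F) (b : X → F),
      ∀ x y, S x y = ⟪b x, b y⟫_ℂ := by
  let K : Matrix X X (ℂ →L[ℂ] ℂ) := Matrix.of fun x y => S x y • ContinuousLinearMap.id ℂ ℂ
  have hS' : ∀ x y, conj (S y x) = S x y := fun x y => hS.1.apply x y
  have hK : Fact K.PosSemidef := ⟨by
    have h := (RKHS.posSemidef_tfae (K := K)).out 0 2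
    refine h.2 ⟨Matrix.IsHermitian.ext fun x y => ?_, fun v => ?_⟩
    · ext
      simp [K, ← hS' x y, ContinuousLinearMap.star_eq_adjoint, ContinuousLinearMap.adjoint_id]
    · have h := posSemidef_sum_nonneg hS v.support v
      have h2 := (Complex.nonneg_iff.1 h).1
      simp only [Finsupp.sum, K, Matrix.of_apply]
      refine h2.trans_eq (congrArg Complex.re (Finset.sum_congr rfl fun x _ =>
        Finset.sum_congr rfl fun y _ => ?_))
      simp [← hS' x y]
      ring⟩
  refine ⟨RKHS.OfKernel K, inferInstance, inferInstance,
    fun x => RKHS.kerFun (RKHS.OfKernel K) x 1, fun x y => ?_⟩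
  rw [RKHS.kerFun_inner, RKHS.kerFun_apply, RKHS.OfKernel.kernel_ofKernel]
  simp [K]

/-- Cauchy-Schwarz for `e` and `∑ c x • a x`, in kernel form. -/
theorem posSemidef_norm_sq_mul_inner_sub {F : Type*} [NormedAddCommGroup F]
    [InnerProductSpace ℂ F] (a : X → F) (e : F) :
    (Matrix.of fun x y => (‖e‖ ^ 2 : ℝ) * ⟪a x, a y⟫_ℂ - ⟪a x, e⟫_ℂ * ⟪e, a y⟫_ℂ).PosSemidef := by
  refine posSemidef_of_sum_nonneg (Matrix.IsHermitian.ext fun x y => ?_) fun s c => ?_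
  · simp [mul_comm]
  · have h1 := sum_conj_mul_inner_mul a s c
    have h2 := sum_conj_mul_inner_mul (fun x => ⟪e, a x⟫_ℂ) s c
    have h3 : ∑ x ∈ s, c x • ⟪e, a x⟫_ℂ = ⟪e, ∑ x ∈ s, c x • a x⟫_ℂ := by
      simp
    rw [h3] at h2
    have key : ∑ x ∈ s, ∑ y ∈ s, conj (c x) *
        ((‖e‖ ^ 2 : ℝ) * ⟪a x, a y⟫_ℂ - ⟪a x, e⟫_ℂ * ⟪e, a y⟫_ℂ) * c y =
        ((‖e‖ ^ 2 * ‖∑ x ∈ s, c x • a x‖ ^ 2 - ‖⟪e, ∑ x ∈ s, c x • a x⟫_ℂ‖ ^ 2 : ℝ) : ℂ) := by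
      rw [Complex.ofReal_sub, Complex.ofReal_mul, ← h1, ← h2, Finset.mul_sum,
        ← Finset.sum_sub_distrib]
      refine Finset.sum_congr rfl fun x _ => ?_
      rw [Finset.mul_sum, ← Finset.sum_sub_distrib]
      refine Finset.sum_congr rfl fun y _ => ?_
      rw [RCLike.inner_apply, inner_conj_symm]
      ring
    simp only [Matrix.of_apply]
    rw [key]
    refine Complex.zero_le_real.2 (sub_nonneg.2 ?_)
    rw [← mul_pow]
    gcongr
    exact norm_inner_le_norm _ _

end PosSemidef

/-! ### Coordinates and multipliers from kernel inequalities. -/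

section Kernel

variable {n : ℕ} {Ω : Set (Fin n → ℂ)}
  {H : Type*} [NormedAddCommGroup H] [InnerProductSpace ℂ H] [CompleteSpace H] [RKHS ℂ H Ω ℂ]
  {D : Type*} [NormedAddCommGroup D] [InnerProductSpace ℂ D] [CompleteSpace D]
  {HD : Type*} [NormedAddCommGroup HD] [InnerProductSpace ℂ HD] [CompleteSpace HD]
  [RKHS ℂ HD Ω D]

theorem inner_kerFun_kerFun_scalar (z w : Ω) (a b : ℂ) :
    ⟪RKHS.kerFun H z a, RKHS.kerFun H w b⟫_ℂ = conj a * scalarKernel H z w * b := by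
  rw [RKHS.kerFun_inner, RKHS.kerFun_apply, scalarKernel]
  have : RKHS.kernel H z w b = b * RKHS.kernel H z w 1 := by
    rw [← smul_eq_mul, ← map_smul, smul_eq_mul, mul_one]
  rw [this, RCLike.inner_apply]
  ring

theorem inner_kerFun_kerFun_kernelD (hHD : RKHS.kernel HD = kernelD H D) (z w : Ω) (a b : D) :
    ⟪RKHS.kerFun HD z a, RKHS.kerFun HD w b⟫_ℂ = scalarKernel H z w * ⟪a, b⟫_ℂ := by
  rw [RKHS.kerFun_inner, RKHS.kerFun_apply, hHD]
  simp [kernelD, inner_smul_right]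

theorem norm_sum_kerFun_sq (s : Finset Ω) (c : Ω → ℂ) :
    ((‖∑ x ∈ s, RKHS.kerFun H x (c x)‖ ^ 2 : ℝ) : ℂ) =
      ∑ x ∈ s, ∑ y ∈ s, conj (c x) * scalarKernel H x y * c y := by
  have h := sum_conj_mul_inner_mul (fun x : Ω => RKHS.kerFun H x (1 : ℂ)) s c
  simp only [← map_smul, smul_eq_mul, mul_one] at h
  rw [← h]
  simp [inner_kerFun_kerFun_scalar, -RKHS.kerFun_inner, -RKHS.inner_kerFun]

/-- The coordinate functions of the elements of `H(K_D)` belong to `H(K)`. -/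
theorem exists_coord (hHD : RKHS.kernel HD = kernelD H D) (f : HD) (d : D) :
    ∃ g : H, ∀ z, g z = ⟪d, f z⟫_ℂ := by
  refine (exists_of_norm_sum_inner_le (E := H) (fun z => ⟪d, f z⟫_ℂ)
    (C := ‖f‖ * ‖d‖) (by positivity) fun s c => ?_).imp fun g hg => hg.1
  have h1 : ∑ x ∈ s, ⟪⟪d, f x⟫_ℂ, c x⟫_ℂ = ⟪f, ∑ x ∈ s, c x • RKHS.kerFun HD x d⟫_ℂ := by
    rw [inner_sum]
    refine Finset.sum_congr rfl fun x _ => ?_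
    rw [inner_smul_right, RKHS.inner_kerFun, RCLike.inner_apply, inner_conj_symm]
  have hd : ⟪d, d⟫_ℂ = ((‖d‖ ^ 2 : ℝ) : ℂ) := by
    rw [Complex.ofReal_pow]
    exact inner_self_eq_norm_sq_to_K d
  have h2 : ‖∑ x ∈ s, c x • RKHS.kerFun HD x d‖ = ‖d‖ * ‖∑ x ∈ s, RKHS.kerFun H x (c x)‖ := by
    rw [← sq_eq_sq₀ (norm_nonneg _) (by positivity), mul_pow]
    apply Complex.ofReal_injective
    rw [← sum_conj_mul_inner_mul, Complex.ofReal_mul, norm_sum_kerFun_sq, Finset.mul_sum]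
    refine Finset.sum_congr rfl fun x _ => ?_
    rw [Finset.mul_sum]
    refine Finset.sum_congr rfl fun y _ => ?_
    rw [inner_kerFun_kerFun_kernelD hHD, hd]
    ring
  rw [h1, mul_assoc, ← h2]
  exact norm_inner_le_norm _ _

/-- If `L` and `K - K L` are positive semidefinite kernels, the functions `L(·, w)` are
multipliers. -/
theorem mem_multiplierAlgebra_of_posSemidef {L : Matrix Ω Ω ℂ} (hL : L.PosSemidef)
    {r : ℝ} (hr : 0 ≤ r)
    (hKL : (Matrix.of fun z w => scalarKernel H z w * (r - L z w)).PosSemidef) (w : Ω) :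
    (fun z => L z w) ∈ multiplierAlgebra H := by
  obtain ⟨F, _, _, l, hl⟩ := exists_feature_map hL
  intro f
  refine (exists_of_norm_sum_inner_le (E := H) (fun z => L z w * f z)
    (C := ‖f‖ * (‖l w‖ * √r)) (by positivity) fun s c => ?_).imp fun g hg => hg.1
  have h1 : ∑ x ∈ s, ⟪L x w * f x, c x⟫_ℂ =
      ⟪f, ∑ x ∈ s, RKHS.kerFun H x (conj (L x w) * c x)⟫_ℂ := by
    rw [inner_sum]
    refine Finset.sum_congr rfl fun x _ => ?_
    simp only [RKHS.inner_kerFun, RCLike.inner_apply, map_mul]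
    ring
  have h2 : ‖∑ x ∈ s, RKHS.kerFun H x (conj (L x w) * c x)‖ ≤
      ‖l w‖ * √r * ‖∑ x ∈ s, RKHS.kerFun H x (c x)‖ := by
    rw [← sq_le_sq₀ (norm_nonneg _) (by positivity), mul_pow, mul_pow, Real.sq_sqrt hr,
      ← sub_nonneg, ← Complex.zero_le_real]
    have hK : (Matrix.of fun z w => scalarKernel H z w).PosSemidef := by
      simpa [inner_kerFun_kerFun_scalar, -RKHS.kerFun_inner, -RKHS.inner_kerFun] using
        posSemidef_inner fun z : Ω => RKHS.kerFun H z (1 : ℂ)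
    -- As kernels in x, y: K(x,y) L(x,w) L(w,y) ≤ ‖l w‖² K L by Cauchy-Schwarz and the Schur product
    -- theorem, then K L ≤ r K by `hKL`.
    have p1 := posSemidef_sum_nonneg (hK.hadamard (posSemidef_norm_sq_mul_inner_sub l (l w))) s c
    have p2 := posSemidef_sum_nonneg hKL s c
    have hw : (0 : ℂ) ≤ ((‖l w‖ ^ 2 : ℝ) : ℂ) := Complex.zero_le_real.2 (sq_nonneg _)
    refine (add_nonneg p1 (mul_nonneg hw p2)).trans_eq ?_
    rw [Complex.ofReal_sub, Complex.ofReal_mul, Complex.ofReal_mul, norm_sum_kerFun_sq,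
      norm_sum_kerFun_sq, Finset.mul_sum, Finset.mul_sum, ← Finset.sum_add_distrib,
      ← Finset.sum_sub_distrib]
    refine Finset.sum_congr rfl fun x _ => ?_
    rw [Finset.mul_sum, Finset.mul_sum, ← Finset.sum_add_distrib, ← Finset.sum_sub_distrib]
    refine Finset.sum_congr rfl fun y _ => ?_
    simp only [Matrix.hadamard_apply, Matrix.of_apply, hl, map_mul, inner_conj_symm]
    ring
  rw [h1]
  refine (norm_inner_le_norm _ _).trans ?_
  rw [mul_assoc]
  gcongr

/-- The difference of the two sides is the sum of the entries over `s` of the Schur product of `hb`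
with the Gram matrix of `v`. This supplies the hypothesis of `exists_row_mul`. -/
theorem sum_norm_sq_le_of_posSemidef (hHD : RKHS.kernel HD = kernelD H D) {ι : Type*} [Fintype ι]
    (b : ι → Ω → ℂ)
    (hb : (Matrix.of fun x y => (1 - ∑ i, b i x * conj (b i y)) *
      scalarKernel H x y).PosSemidef) (s : Finset Ω) (v : Ω → D) :
    ∑ i, ‖∑ x ∈ s, conj (b i x) • RKHS.kerFun HD x (v x)‖ ^ 2 ≤
      ‖∑ x ∈ s, RKHS.kerFun HD x (v x)‖ ^ 2 := by
  have p := posSemidef_sum_nonneg (hb.hadamard (posSemidef_inner v)) s 1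
  rw [← sub_nonneg, ← Complex.zero_le_real]
  refine p.trans_eq ?_
  have h1 := sum_conj_mul_inner_mul (fun x => RKHS.kerFun HD x (v x)) s 1
  have h2 := fun i => sum_conj_mul_inner_mul (fun x => RKHS.kerFun HD x (v x)) s
    fun x => conj (b i x)
  simp only [Pi.one_apply, one_smul] at h1
  rw [Complex.ofReal_sub, Complex.ofReal_sum, ← h1, ← Finset.sum_congr rfl fun i _ => h2 i,
    Finset.sum_comm (s := Finset.univ), ← Finset.sum_sub_distrib]
  refine Finset.sum_congr rfl fun x _ => ?_
  rw [Finset.sum_comm, ← Finset.sum_sub_distrib]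
  refine Finset.sum_congr rfl fun y _ => ?_
  simp only [inner_kerFun_kerFun_kernelD hHD, Matrix.hadamard_apply, Matrix.of_apply, Pi.one_apply,
    map_one, Complex.conj_conj, one_mul, mul_one, sub_mul, Finset.sum_mul]
  congr 1
  refine Finset.sum_congr rfl fun i _ => ?_
  ring

end Kernel

/-! ### Fibers and functions with coefficients in an algebra. -/

section Coeffs

variable {X D E : Type*} [NormedAddCommGroup D] [InnerProductSpace ℂ D]
  [NormedAddCommGroup E] [InnerProductSpace ℂ E] [RKHS ℂ E X D]

theorem mem_fiber {M : Submodule ℂ E} {z : X} {d : D} : d ∈ fiber M z ↔ ∃ f ∈ M, f z = d :=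
  Iff.rfl

theorem fiber_mono {M N : Submodule ℂ E} (h : M ≤ N) (z : X) : fiber M z ≤ fiber N z :=
  Submodule.map_mono h

theorem coe_sum_apply {ι : Type*} (s : Finset ι) (g : ι → E) (z : X) :
    (∑ i ∈ s, g i) z = ∑ i ∈ s, g i z := by
  rw [← RKHS.coeCLM_apply (𝕜 := ℂ), map_sum, Finset.sum_apply]
  rfl

theorem IsInvariant.exists_sum {A : Subalgebra ℂ (X → ℂ)} {M : Submodule ℂ E}
    (hM : IsInvariant A M) {ι : Type*} [Fintype ι] {φ : ι → X → ℂ} (hφ : ∀ i, φ i ∈ A)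
    {f : ι → E} (hf : ∀ i, f i ∈ M) : ∃ g ∈ M, ∀ z, g z = ∑ i, φ i z • f i z := by
  choose g hgM hg using fun i => hM (φ i) (hφ i) (f i) (hf i)
  exact ⟨∑ i, g i, M.sum_mem fun i _ => hgM i, fun z => by simp [coe_sum_apply, hg]⟩

/-- Testing all functionals removes the choice of basis, so the condition is visibly linear in `f`.
-/
theorem hasCoeffsIn_iff [FiniteDimensional ℂ D] {A : Subalgebra ℂ (X → ℂ)} {f : X → D} :
    HasCoeffsIn A f ↔ ∀ l : D →ₗ[ℂ] ℂ, (fun z => l (f z)) ∈ A := by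
  constructor
  · rintro ⟨b, hb⟩ l
    have : (fun z => l (f z)) = ∑ i, l (b i) • fun z => b.repr (f z) i := by
      ext z
      rw [← b.sum_repr (f z), map_sum, Finset.sum_apply]
      simp [mul_comm]
    rw [this]
    exact A.sum_mem fun i _ => A.smul_mem (hb i) _
  · intro h
    exact ⟨Module.finBasis ℂ D, fun i => h ((Module.finBasis ℂ D).coord i)⟩

/-- The elements of `M` all of whose coordinate functions belong to `A`. -/
def coeffSubmodule (A : Subalgebra ℂ (X → ℂ)) (M : Submodule ℂ E) : Submodule ℂ E where
  carrier := {f | f ∈ M ∧ ∀ l : D →ₗ[ℂ] ℂ, (fun z => l (f z)) ∈ A}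
  add_mem' := fun {f g} hf hg => ⟨M.add_mem hf.1 hg.1, fun l =>
    (congrArg (· ∈ A) (funext fun z => by simp)).mpr (A.add_mem (hf.2 l) (hg.2 l))⟩
  zero_mem' := ⟨M.zero_mem, fun l =>
    (congrArg (· ∈ A) (funext fun z => by simp)).mpr A.zero_mem⟩
  smul_mem' := fun c f hf => ⟨M.smul_mem c hf.1, fun l =>
    (congrArg (· ∈ A) (funext fun z => by simp)).mpr (A.smul_mem (hf.2 l) c)⟩

theorem mem_coeffSubmodule {A : Subalgebra ℂ (X → ℂ)} {M : Submodule ℂ E} {f : E} :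
    f ∈ coeffSubmodule A M ↔ f ∈ M ∧ ∀ l : D →ₗ[ℂ] ℂ, (fun z => l (f z)) ∈ A :=
  Iff.rfl

/-- Pointwise limits suffice, because the right-hand fiber is a finite-dimensional, hence closed,
subspace of `D`. -/
theorem IsDenseIn.fiber_le [FiniteDimensional ℂ D] {A : Subalgebra ℂ (X → ℂ)} {M : Submodule ℂ E}
    (h : IsDenseIn A M) (z : X) : fiber M z ≤ fiber (coeffSubmodule A M) z := by
  rintro _ ⟨f, hf, rfl⟩
  obtain ⟨u, hu, hlim⟩ := h f hf
  refine (Submodule.closed_of_finiteDimensional (fiber (coeffSubmodule A M) z)).mem_of_tendsto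
    (hlim z) (Filter.Eventually.of_forall fun k => ?_)
  exact mem_fiber.2 ⟨u k, ⟨(hu k).1, hasCoeffsIn_iff.1 (hu k).2⟩, rfl⟩

end Coeffs

/-! ### Invariant subspaces for complete Nevanlinna-Pick kernels. -/

section NevanlinnaPick

variable {n : ℕ} {Ω : Set (Fin n → ℂ)}
  {H : Type*} [NormedAddCommGroup H] [InnerProductSpace ℂ H] [CompleteSpace H] [RKHS ℂ H Ω ℂ]
  {D : Type*} [NormedAddCommGroup D] [InnerProductSpace ℂ D] [CompleteSpace D]
  {HD : Type*} [NormedAddCommGroup HD] [InnerProductSpace ℂ HD] [CompleteSpace HD]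
  [RKHS ℂ HD Ω D]

/-- With L = 1 - 1/K, the kernel K(1 - L) is the constant 1. -/
theorem IsCompleteNevanlinnaPick.mem_multiplierAlgebra
    (hK : IsCompleteNevanlinnaPick (scalarKernel H)) (w : Ω) :
    (fun z => 1 - 1 / scalarKernel H z w) ∈ multiplierAlgebra H := by
  refine mem_multiplierAlgebra_of_posSemidef hK.2 zero_le_one ?_ w
  convert posSemidef_inner fun _ : Ω => (1 : ℂ) using 1
  ext z w
  simp [hK.1 z w]

theorem IsCompleteNevanlinnaPick.inv_mem_multiplierAlgebra
    (hK : IsCompleteNevanlinnaPick (scalarKernel H)) (w : Ω) :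
    (fun z => (scalarKernel H z w)⁻¹) ∈ multiplierAlgebra H := by
  have := (multiplierAlgebra H).sub_mem (multiplierAlgebra H).one_mem (hK.mem_multiplierAlgebra w)
  convert this using 1
  ext z
  simp

variable (M : Submodule ℂ HD) [M.HasOrthogonalProjection]

theorem inner_projection_kerFun (z : Ω) (v : D) {f : HD} (hf : f ∈ M) :
    ⟪M.starProjection (RKHS.kerFun HD z v), f⟫_ℂ = ⟪v, f z⟫_ℂ := by
  rw [M.inner_starProjection_left_eq_right, M.starProjection_eq_self_iff.2 hf, RKHS.kerFun_inner]

/-- The reproducing kernel of an invariant subspace, divided by a complete Nevanlinna-Pick kernel,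
is positive semidefinite. -/
theorem IsCompleteNevanlinnaPick.posSemidef_inner_projection
    (hK : IsCompleteNevanlinnaPick (scalarKernel H)) (hHD : RKHS.kernel HD = kernelD H D)
    (hM : IsInvariant (multiplierAlgebra H) M) (v : D) :
    (Matrix.of fun z w => ⟪M.starProjection (RKHS.kerFun HD z v),
      M.starProjection (RKHS.kerFun HD w v)⟫_ℂ * (scalarKernel H z w)⁻¹).PosSemidef := by
  obtain ⟨F, _, _, b, hb⟩ := exists_feature_map hK.2
  simp only [Matrix.of_apply] at hb
  have hinv : ∀ z w, (scalarKernel H z w)⁻¹ = 1 - ⟪b z, b w⟫_ℂ := fun z w => by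
    rw [← hb]; simp
  set p : Ω → HD := fun z => M.starProjection (RKHS.kerFun HD z v) with hp
  have hpM : ∀ z, p z ∈ M := fun z => M.starProjection_apply_mem _
  refine posSemidef_of_sum_nonneg (Matrix.IsHermitian.ext fun x y => ?_) fun s c => ?_
  · simp only [Matrix.of_apply, hinv, star_mul', RCLike.star_def, map_sub, map_one,
      inner_conj_symm]
  -- Only the points of `s` are tested, so projecting the feature map to this finite-dimensional
  -- span loses nothing and leaves a finite row `B` of multipliers.
  let W : Submodule ℂ F := Submodule.span ℂ (b '' s)
  have : FiniteDimensional ℂ W := FiniteDimensional.span_of_finite ℂ (s.finite_toSet.image b)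
  let e := stdOrthonormalBasis ℂ W
  let B : Fin (Module.finrank ℂ W) → Ω → ℂ := fun i z => ⟪b z, (e i : F)⟫_ℂ
  have hBsum : ∀ x y, ∑ i, B i x * conj (B i y) =
      ⟪W.starProjection (b x), W.starProjection (b y)⟫_ℂ := by
    intro x y
    have := e.sum_inner_mul_inner (W.orthogonalProjectionOnto (b x))
      (W.orthogonalProjectionOnto (b y))
    simp only [Submodule.inner_orthogonalProjectionOnto_eq_of_mem_left,
      Submodule.inner_orthogonalProjectionOnto_eq_of_mem_right, inner_conj_symm, B] at this ⊢
    rw [this, ← W.inner_starProjection_left_eq_right,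
      W.starProjection_eq_self_iff.2 (W.starProjection_apply_mem _)]
    rfl
  have hBmem : ∀ i, B i ∈ multiplierAlgebra H := by
    intro i
    have key : ∀ f ∈ W, (fun z => ⟪b z, f⟫_ℂ) ∈ multiplierAlgebra H := by
      intro f hf
      induction hf using Submodule.span_induction with
      | mem f hf =>
        obtain ⟨w, -, rfl⟩ := hf
        simp only [← hb]
        exact hK.mem_multiplierAlgebra w
      | zero =>
        exact (congrArg (· ∈ multiplierAlgebra H) (funext fun z => by simp)).mpr
          (multiplierAlgebra H).zero_mem
      | add f g _ _ hf hg =>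
        exact (congrArg (· ∈ multiplierAlgebra H) (funext fun z => by simp)).mpr
          ((multiplierAlgebra H).add_mem hf hg)
      | smul a f _ hf =>
        exact (congrArg (· ∈ multiplierAlgebra H) (funext fun z => by simp)).mpr
          ((multiplierAlgebra H).smul_mem hf a)
    exact key _ (e i).2
  have hB : (Matrix.of fun x y => (1 - ∑ i, B i x * conj (B i y)) *
      scalarKernel H x y).PosSemidef := by
    -- Since K(1 - ⟪b x, b y⟫) = 1, truncating to `W` adds only K times the Gram kernel of the
    -- components orthogonal to `W`.
    have h1 := (posSemidef_inner fun z : Ω => RKHS.kerFun H z (1 : ℂ)).hadamard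
      (posSemidef_inner fun z => b z - W.starProjection (b z))
    have h2 := h1.add (posSemidef_inner fun _ : Ω => (1 : ℂ))
    refine (congrArg Matrix.PosSemidef (Matrix.ext fun x y => ?_)).mpr h2
    have h3 : ⟪b x - W.starProjection (b x), b y - W.starProjection (b y)⟫_ℂ =
        ⟪b x, b y⟫_ℂ - ⟪W.starProjection (b x), W.starProjection (b y)⟫_ℂ := by
      have hx : ⟪b x - W.starProjection (b x), W.starProjection (b y)⟫_ℂ = 0 :=
        W.starProjection_inner_eq_zero _ _ (W.starProjection_apply_mem _)
      have hy : ⟪W.starProjection (b x), b y - W.starProjection (b y)⟫_ℂ = 0 := by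
        rw [← inner_conj_symm, W.starProjection_inner_eq_zero _ _ (W.starProjection_apply_mem _),
          map_zero]
      rw [inner_sub_right, hx, sub_zero, inner_sub_left]
      rw [inner_sub_right, sub_eq_zero] at hy
      rw [hy]
    have h4 : scalarKernel H x y * (1 - ⟪b x, b y⟫_ℂ) = 1 := by
      rw [← hinv, mul_inv_cancel₀ (hK.1 x y)]
    simp only [Matrix.of_apply, Matrix.add_apply, Matrix.hadamard_apply, h3, hBsum,
      inner_kerFun_kerFun_scalar, map_one, one_mul, mul_one, RCLike.inner_apply]
    linear_combination h4
  have hcontr := sum_norm_sq_le_of_posSemidef hHD B hB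
  -- `y i` is the adjoint of multiplication by `B i` on `M`, applied to `∑ c x • p x`. Contractivity
  -- of the row gives `hle`, the required positivity.
  let y : Fin (Module.finrank ℂ W) → HD := fun i => ∑ x ∈ s, (conj (B i x) * c x) • p x
  have hyM : ∀ i, y i ∈ M := fun i => M.sum_mem fun x _ => M.smul_mem _ (hpM x)
  choose g hgM hg using fun i => hM (B i) (hBmem i) (y i) (hyM i)
  obtain ⟨G, hG, hGn⟩ := exists_row_mul B hcontr y
  have hGg : G = ∑ i, g i := by
    refine RKHS.ext fun x => ?_
    simp only [hG, coe_sum_apply, hg]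
  have hyg : ∀ i, ((‖y i‖ ^ 2 : ℝ) : ℂ) = ⟪∑ x ∈ s, c x • p x, g i⟫_ℂ := by
    intro i
    rw [Complex.ofReal_pow, ← Complex.coe_algebraMap, ← inner_self_eq_norm_sq_to_K (𝕜 := ℂ)]
    rw [show ⟪y i, y i⟫_ℂ = ⟪∑ x ∈ s, (conj (B i x) * c x) • p x, y i⟫_ℂ from rfl, sum_inner,
      sum_inner]
    refine Finset.sum_congr rfl fun x _ => ?_
    rw [inner_smul_left, inner_smul_left, hp, inner_projection_kerFun M x v (hyM i),
      inner_projection_kerFun M x v (hgM i), hg, inner_smul_right, map_mul, Complex.conj_conj]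
    ring
  have hsum : ((∑ i, ‖y i‖ ^ 2 : ℝ) : ℂ) = ⟪∑ x ∈ s, c x • p x, G⟫_ℂ := by
    rw [hGg, inner_sum, Complex.ofReal_sum]
    exact Finset.sum_congr rfl fun i _ => hyg i
  have hle : ∑ i, ‖y i‖ ^ 2 ≤ ‖∑ x ∈ s, c x • p x‖ ^ 2 := by
    set Y := ∑ i, ‖y i‖ ^ 2
    have hY : 0 ≤ Y := Finset.sum_nonneg fun i _ => sq_nonneg _
    have h1 : Y ≤ ‖∑ x ∈ s, c x • p x‖ * √Y := by
      calc Y = ‖(Y : ℂ)‖ := by rw [Complex.norm_real, Real.norm_of_nonneg hY]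
        _ ≤ ‖∑ x ∈ s, c x • p x‖ * ‖G‖ := hsum ▸ norm_inner_le_norm _ _
        _ ≤ _ := by gcongr
    have h2 := Real.sq_sqrt hY
    nlinarith [Real.sqrt_nonneg Y, sq_nonneg (‖∑ x ∈ s, c x • p x‖ - √Y)]
  rw [← sub_nonneg, ← Complex.zero_le_real] at hle
  refine hle.trans_eq ?_
  rw [Complex.ofReal_sub, Complex.ofReal_sum, ← sum_conj_mul_inner_mul,
    Finset.sum_congr rfl fun i _ => (sum_conj_mul_inner_mul p s fun x => conj (B i x) * c x).symm,
    Finset.sum_comm (s := Finset.univ), ← Finset.sum_sub_distrib]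
  refine Finset.sum_congr rfl fun x hx => ?_
  rw [Finset.sum_comm, ← Finset.sum_sub_distrib]
  refine Finset.sum_congr rfl fun y hy => ?_
  have hbx : ∀ x ∈ s, W.starProjection (b x) = b x := fun x hx =>
    W.starProjection_eq_self_iff.2 (Submodule.subset_span ⟨x, hx, rfl⟩)
  have h5 := hBsum x y
  rw [hbx x hx, hbx y hy] at h5
  simp only [Matrix.of_apply, hinv, ← h5, map_mul, Complex.conj_conj, mul_sub, sub_mul, mul_one,
    Finset.mul_sum, Finset.sum_mul]
  congr 1
  refine Finset.sum_congr rfl fun i _ => ?_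
  ring

/-- Quotients of the reproducing kernel of an invariant subspace by a complete Nevanlinna-Pick
kernel have multipliers as coordinate functions. -/
theorem IsCompleteNevanlinnaPick.inner_projection_mem_multiplierAlgebra
    (hK : IsCompleteNevanlinnaPick (scalarKernel H)) (hHD : RKHS.kernel HD = kernelD H D)
    (hM : IsInvariant (multiplierAlgebra H) M) (u v : D) (w : Ω) :
    (fun z => ⟪M.starProjection (RKHS.kerFun HD z u),
      M.starProjection (RKHS.kerFun HD w v)⟫_ℂ * (scalarKernel H z w)⁻¹) ∈
        multiplierAlgebra H := by
  have diag : ∀ v : D, (fun z => ⟪M.starProjection (RKHS.kerFun HD z v),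
      M.starProjection (RKHS.kerFun HD w v)⟫_ℂ * (scalarKernel H z w)⁻¹) ∈
        multiplierAlgebra H := by
    intro v
    refine mem_multiplierAlgebra_of_posSemidef (r := ‖v‖ ^ 2)
      (hK.posSemidef_inner_projection M hHD hM v) (sq_nonneg _) ?_ w
    -- K(‖v‖² - L) is the kernel of the orthogonal complement of `M`, compressed to `v`.
    convert posSemidef_inner fun z : Ω =>
      RKHS.kerFun HD z v - M.starProjection (RKHS.kerFun HD z v) using 1
    ext x y
    have h1 : ⟪RKHS.kerFun HD x v - M.starProjection (RKHS.kerFun HD x v),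
        M.starProjection (RKHS.kerFun HD y v)⟫_ℂ = 0 :=
      M.starProjection_inner_eq_zero _ _ (M.starProjection_apply_mem _)
    have h2 : ⟪M.starProjection (RKHS.kerFun HD x v), RKHS.kerFun HD y v⟫_ℂ =
        ⟪M.starProjection (RKHS.kerFun HD x v), M.starProjection (RKHS.kerFun HD y v)⟫_ℂ := by
      rw [← M.inner_starProjection_left_eq_right,
        M.starProjection_eq_self_iff.2 (M.starProjection_apply_mem _)]
    simp only [Matrix.of_apply]
    rw [inner_sub_right, h1, sub_zero, inner_sub_left, h2, inner_kerFun_kerFun_kernelD hHD,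
      inner_self_eq_norm_sq_to_K, mul_sub, mul_left_comm, mul_inv_cancel₀ (hK.1 x y), mul_one,
      Complex.ofReal_pow]
    rfl
  let A := multiplierAlgebra H
  -- Polarization in `u`, `v`.
  have h := A.smul_mem (A.add_mem (A.sub_mem (diag (u + v)) (diag (u - v)))
    (A.sub_mem (A.smul_mem (diag (u - Complex.I • v)) Complex.I)
      (A.smul_mem (diag (u + Complex.I • v)) Complex.I))) (1 / 4 : ℂ)
  convert h using 1
  ext z
  simp only [map_add, map_sub, map_smul, inner_add_left, inner_add_right, inner_sub_left,
    inner_sub_right, inner_smul_left, inner_smul_right, Complex.conj_I, Pi.smul_apply,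
    Pi.add_apply, Pi.sub_apply, smul_eq_mul]
  linear_combination (1/2*(scalarKernel H z w)⁻¹ * (⟪M.starProjection (RKHS.kerFun HD z u),
      M.starProjection (RKHS.kerFun HD w v)⟫_ℂ - ⟪M.starProjection (RKHS.kerFun HD z v),
      M.starProjection (RKHS.kerFun HD w u)⟫_ℂ)) * Complex.I_sq

/-- Every fiber of an invariant subspace of `H(K_D)` is spanned by values of functions with
multiplier coefficients. -/
theorem IsCompleteNevanlinnaPick.fiber_le [FiniteDimensional ℂ D]
    (hK : IsCompleteNevanlinnaPick (scalarKernel H)) (hHD : RKHS.kernel HD = kernelD H D)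
    (hM : IsInvariant (multiplierAlgebra H) M) (w : Ω) :
    fiber M w ≤ fiber (coeffSubmodule (multiplierAlgebra H) M) w := by
  set N := fiber (coeffSubmodule (multiplierAlgebra H) M) w
  have hN : N ≤ fiber M w := fiber_mono (fun f hf => (mem_coeffSubmodule.1 hf).1) w
  intro d hd
  suffices h : ∀ d ∈ fiber M w, d ∈ Nᗮ → d = 0 by
    have h1 : d - N.starProjection d = 0 :=
      h _ (Submodule.sub_mem _ hd (hN (N.starProjection_apply_mem d)))
        (N.sub_starProjection_mem_orthogonal d)
    rw [sub_eq_zero.1 h1]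
    exact N.starProjection_apply_mem d
  intro d hd hdN
  obtain ⟨f, hf, hfd⟩ := mem_fiber.1 hd
  obtain ⟨g, hgM, hg⟩ := hM _ (hK.inv_mem_multiplierAlgebra w) _
    (M.starProjection_apply_mem (RKHS.kerFun HD w d))
  have hgu : ∀ (u : D) (z : Ω), ⟪u, g z⟫_ℂ = ⟪M.starProjection (RKHS.kerFun HD z u),
      M.starProjection (RKHS.kerFun HD w d)⟫_ℂ * (scalarKernel H z w)⁻¹ := fun u z => by
    rw [inner_projection_kerFun M z u (M.starProjection_apply_mem _), hg, inner_smul_right,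
      mul_comm]
  have hgN : g w ∈ N := by
    refine mem_fiber.2 ⟨g, ⟨hgM, fun l => ?_⟩, rfl⟩
    have h := hK.inner_projection_mem_multiplierAlgebra M hHD hM
      ((InnerProductSpace.toDual ℂ D).symm l.toContinuousLinearMap) d w
    simp only [← hgu, InnerProductSpace.toDual_symm_apply] at h
    exact h
  -- ⟪d, g(w)⟫ = ‖P k_w d‖² / K(w,w) vanishes, so `d` is orthogonal to every value f(w) with f in
  -- `M`, in particular to itself.
  have h0 := Submodule.inner_left_of_mem_orthogonal hgN hdN
  rw [hgu, mul_eq_zero, or_iff_left (inv_ne_zero (hK.1 w w)), inner_self_eq_zero] at h0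
  have h1 := inner_projection_kerFun M w d hf
  rw [h0, inner_zero_left, hfd, eq_comm, inner_self_eq_zero] at h1
  exact h1

end NevanlinnaPick

/-! ### Determinants over a function algebra. -/

section Determinants

variable {X : Type*} {ι : Type*} [Fintype ι] [DecidableEq ι]

theorem det_mem (A : Subalgebra ℂ (X → ℂ)) {N : ι → ι → X → ℂ} (hN : ∀ i j, N i j ∈ A) :
    (fun z => (Matrix.of fun i j => N i j z).det) ∈ A := by
  let N' : Matrix ι ι A := Matrix.of fun i j => ⟨N i j, hN i j⟩
  convert N'.det.2 using 1
  ext z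
  exact (((Pi.evalRingHom (fun _ : X => ℂ) z).comp A.val.toRingHom).map_det N').symm

theorem adjugate_mem (A : Subalgebra ℂ (X → ℂ)) {N : ι → ι → X → ℂ} (hN : ∀ i j, N i j ∈ A)
    (i j : ι) : (fun z => (Matrix.of fun i j => N i j z).adjugate i j) ∈ A := by
  let N' : Matrix ι ι A := Matrix.of fun i j => ⟨N i j, hN i j⟩
  convert (N'.adjugate i j).2 using 1
  ext z
  exact (congrFun (congrFun (((Pi.evalRingHom (fun _ : X => ℂ) z).comp
    A.val.toRingHom).map_adjugate N') i) j).symm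

variable {D : Type*} [AddCommGroup D] [Module ℂ D]

theorem exists_dual_family {v : ι → D} (hv : LinearIndependent ℂ v) :
    ∃ L : D →ₗ[ℂ] ι → ℂ, ∀ j, L (v j) = Pi.single j 1 := by
  obtain ⟨L, hL⟩ := LinearMap.exists_leftInverse_of_injective (Fintype.linearCombination ℂ v)
    (LinearMap.ker_eq_bot.2 hv.fintypeLinearCombination_injective)
  refine ⟨L, fun j => ?_⟩
  have := LinearMap.congr_fun hL (Pi.single j 1)
  simpa using this

theorem linearIndependent_of_det_ne_zero {v : ι → D} (L : D →ₗ[ℂ] ι → ℂ)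
    (h : (Matrix.of fun i j => L (v j) i).det ≠ 0) : LinearIndependent ℂ v := by
  refine LinearIndependent.of_comp L ?_
  exact Matrix.linearIndependent_cols_of_det_ne_zero h

end Determinants

/-! ### Generic fibers, sums and intersections. -/

section FiberDimension

variable {X D E : Type*} [NormedAddCommGroup D] [InnerProductSpace ℂ D] [FiniteDimensional ℂ D]
  [NormedAddCommGroup E] [InnerProductSpace ℂ E] [RKHS ℂ E X D]

theorem finrank_fiber_le_fd (M : Submodule ℂ E) (z : X) :
    Module.finrank ℂ (fiber M z) ≤ fd M :=
  le_ciSup (f := fun z => Module.finrank ℂ (fiber M z))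
    ⟨Module.finrank ℂ D, by rintro _ ⟨z, rfl⟩; exact Submodule.finrank_le _⟩ z

theorem exists_finrank_fiber_eq_fd [Nonempty X] (M : Submodule ℂ E) :
    ∃ z : X, Module.finrank ℂ (fiber M z) = fd M :=
  Nat.sSup_mem (Set.range_nonempty _)
    ⟨Module.finrank ℂ D, by rintro _ ⟨z, rfl⟩; exact Submodule.finrank_le _⟩

theorem fiber_topologicalClosure_sup (M₁ M₂ : Submodule ℂ E) (z : X) :
    fiber (M₁ ⊔ M₂).topologicalClosure z = fiber M₁ z ⊔ fiber M₂ z := by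
  have hsup : fiber (M₁ ⊔ M₂) z = fiber M₁ z ⊔ fiber M₂ z := Submodule.map_sup _ _ _
  refine le_antisymm ?_ (hsup ▸ fiber_mono (Submodule.le_topologicalClosure _) z)
  rw [← hsup]
  rintro _ ⟨f, hf, rfl⟩
  have h := map_mem_closure (RKHS.continuous_eval z) hf
    (t := (fiber (M₁ ⊔ M₂) z : Set D)) fun g hg => mem_fiber.2 ⟨g, hg, rfl⟩
  rwa [(Submodule.closed_of_finiteDimensional _).closure_eq] at h

/-- If the coordinate functions of all elements of `E` belong to `A`, then the fibers of `M` have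
maximal dimension off the zero set of some nonzero element of `A`. -/
theorem exists_mem_forall_ne_zero_finrank_eq_fd [Nonempty X] {A : Subalgebra ℂ (X → ℂ)}
    (hA : ∀ (f : E) (l : D →ₗ[ℂ] ℂ), (fun z => l (f z)) ∈ A) (M : Submodule ℂ E) :
    ∃ δ ∈ A, δ ≠ 0 ∧ ∀ z, δ z ≠ 0 → Module.finrank ℂ (fiber M z) = fd M := by
  obtain ⟨z₀, hz₀⟩ := exists_finrank_fiber_eq_fd M
  let b := Module.finBasis ℂ (fiber M z₀)
  have hb : LinearIndependent ℂ fun i => (b i : D) :=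
    b.linearIndependent.map' (fiber M z₀).subtype (Submodule.ker_subtype _)
  choose f hfM hf using fun i => mem_fiber.1 (b i).2
  obtain ⟨L, hL⟩ := exists_dual_family hb
  -- This determinant is 1 at `z₀`; where it is nonzero, the values of the `f i` stay independent.
  refine ⟨_, det_mem A (N := fun i j z => L (f j z) i) fun i j =>
    hA (f j) (LinearMap.proj i ∘ₗ L), fun h => ?_, fun z hz => ?_⟩
  · have h1 := congrFun h z₀
    have h2 : (Matrix.of fun i j => L (f j z₀) i) = 1 := by
      ext i j
      simp [hf, hL, Matrix.one_apply, Pi.single_apply]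
    simp [h2] at h1
  · refine le_antisymm (finrank_fiber_le_fd M z) ?_
    have hind := linearIndependent_of_det_ne_zero L hz
    have hle : Submodule.span ℂ (Set.range fun i => f i z) ≤ fiber M z :=
      Submodule.span_le.2 (by rintro _ ⟨i, rfl⟩; exact mem_fiber.2 ⟨f i, hfM i, rfl⟩)
    have := Submodule.finrank_mono hle
    rwa [finrank_span_eq_card hind, Fintype.card_fin, hz₀] at this

/-- A basis of V₁ is completed by vectors of V₂: intersecting V₂ with a complement of V₁ ∩ V₂ gives
a complement of V₁ in V₁ + V₂. -/
theorem exists_basis_family_sup (V₁ V₂ : Submodule ℂ D) :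
    ∃ (k l : ℕ) (v : Fin k ⊕ Fin l → D), LinearIndependent ℂ v ∧
      k + l = Module.finrank ℂ ↑(V₁ ⊔ V₂) ∧ Submodule.span ℂ (Set.range (v ∘ Sum.inl)) = V₁ ∧
      ∀ j, v (Sum.inr j) ∈ V₂ := by
  obtain ⟨C, hC⟩ := exists_isCompl (V₁ ⊓ V₂)
  set U := C ⊓ V₂
  have hdis : V₁ ⊓ U = ⊥ := by
    rw [← hC.inf_eq_bot]
    simp only [U]
    ac_rfl
  have hsup : V₁ ⊔ U = V₁ ⊔ V₂ := by
    refine le_antisymm (sup_le_sup_left inf_le_right _) (sup_le le_sup_left ?_)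
    calc V₂ = (V₁ ⊓ V₂ ⊔ C) ⊓ V₂ := by rw [hC.sup_eq_top, top_inf_eq]
      _ = V₁ ⊓ V₂ ⊔ C ⊓ V₂ := sup_inf_assoc_of_le _ inf_le_right
      _ ≤ V₁ ⊔ U := sup_le_sup_right inf_le_left _
  let b := Module.finBasis ℂ V₁
  let b' := Module.finBasis ℂ U
  have hspan : ∀ (V : Submodule ℂ D),
      Submodule.span ℂ (Set.range fun i => (Module.finBasis ℂ V i : D)) = V := fun V => by
    have := congrArg (Submodule.map V.subtype) (Module.finBasis ℂ V).span_eq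
    rw [Submodule.map_span, ← Set.range_comp, Submodule.map_top, Submodule.range_subtype] at this
    exact this
  refine ⟨_, _, Sum.elim (fun i => (b i : D)) fun i => (b' i : D), ?_, ?_, hspan V₁,
    fun j => (b' j).2.2⟩
  · refine LinearIndependent.sum_type
      (b.linearIndependent.map' V₁.subtype (Submodule.ker_subtype _))
      (b'.linearIndependent.map' U.subtype (Submodule.ker_subtype _)) ?_
    rw [disjoint_iff, ← hdis]
    exact congrArg₂ _ (hspan V₁) (hspan U)
  · have := Submodule.finrank_sup_add_finrank_inf_eq V₁ U
    rw [hdis, hsup, finrank_bot, add_zero] at this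
    exact this.symm

/-- At a point where the fiber of the sum has maximal dimension, the fiber of the intersection is
the intersection of the fibers. -/
theorem fiber_inf_fiber_le {A : Subalgebra ℂ (X → ℂ)} {M₁ M₂ : Submodule ℂ E}
    (hM₁ : IsInvariant A M₁) (hM₂ : IsInvariant A M₂) {z₀ : X}
    (h₁ : fiber M₁ z₀ ≤ fiber (coeffSubmodule A M₁) z₀)
    (h₂ : fiber M₂ z₀ ≤ fiber (coeffSubmodule A M₂) z₀)
    (hmax : ∀ z, Module.finrank ℂ ↑(fiber M₁ z ⊔ fiber M₂ z) ≤
      Module.finrank ℂ ↑(fiber M₁ z₀ ⊔ fiber M₂ z₀)) :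
    fiber M₁ z₀ ⊓ fiber M₂ z₀ ≤ fiber (M₁ ⊓ M₂) z₀ := by
  obtain ⟨k, l, v, hv, hcard, hv₁, hv₂⟩ := exists_basis_family_sup (fiber M₁ z₀) (fiber M₂ z₀)
  have hv₁' : ∀ i, v (Sum.inl i) ∈ fiber M₁ z₀ := fun i => by
    rw [← hv₁]
    exact Submodule.subset_span ⟨i, rfl⟩
  choose f hf hfv using fun i => mem_fiber.1 (h₁ (hv₁' i))
  choose p hp hpv using fun j => mem_fiber.1 (h₂ (hv₂ j))
  rintro w ⟨hw₁, hw₂⟩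
  obtain ⟨q, hq, rfl⟩ := mem_fiber.1 (h₂ hw₂)
  let F : Fin k ⊕ Fin l → E := Sum.elim f p
  have hFv : ∀ j, F j z₀ = v j := by
    rintro (j | j)
    exacts [hfv j, hpv j]
  have hFA : ∀ j (L : D →ₗ[ℂ] ℂ), (fun z => L (F j z)) ∈ A := by
    rintro (j | j)
    exacts [(hf j).2, (hp j).2]
  obtain ⟨L, hL⟩ := exists_dual_family hv
  let N : X → Matrix (Fin k ⊕ Fin l) (Fin k ⊕ Fin l) ℂ := fun z =>
    Matrix.of fun i j => L (F j z) i
  have hNA : ∀ i j, (fun z => L (F j z) i) ∈ A := fun i j => hFA j (LinearMap.proj i ∘ₗ L)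
  let δ : X → ℂ := fun z => (N z).det
  have hδ : δ ∈ A := det_mem A hNA
  -- Cramer numerators: using the adjugate instead of the inverse keeps them in `A`.
  let c : Fin k ⊕ Fin l → X → ℂ := fun i z => ((N z).adjugate.mulVec (L (q z))) i
  have hc : ∀ i, c i ∈ A := fun i => by
    have : c i = ∑ j, (fun z => (N z).adjugate i j) * fun z => L (q z) j := by
      ext z
      simp [c, Matrix.mulVec, dotProduct]
    rw [this]
    exact A.sum_mem fun j _ => A.mul_mem (adjugate_mem A hNA i j)
      (hq.2 (LinearMap.proj j ∘ₗ L))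
  -- The extra factor `δ` makes the identity trivial on the zeros of `δ`. Elsewhere the values `F j
  -- z` are independent, and maximality at `z₀` forces them to span the sum of the fibers.
  have cramer : ∀ z, (δ * δ) z • q z = ∑ j, (δ * c j) z • F j z := by
    intro z
    by_cases hz : δ z = 0
    · simp [hz]
    have hind : LinearIndependent ℂ fun j => F j z := linearIndependent_of_det_ne_zero L hz
    have hle : Submodule.span ℂ (Set.range fun j => F j z) ≤ fiber M₁ z ⊔ fiber M₂ z := by
      refine Submodule.span_le.2 ?_
      rintro _ ⟨j | j, rfl⟩
      · exact Submodule.mem_sup_left (mem_fiber.2 ⟨f j, (hf j).1, rfl⟩)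
      · exact Submodule.mem_sup_right (mem_fiber.2 ⟨p j, (hp j).1, rfl⟩)
    have heq := Submodule.eq_of_le_of_finrank_le hle (by
      rw [finrank_span_eq_card hind, Fintype.card_sum, Fintype.card_fin, Fintype.card_fin, hcard]
      exact hmax z)
    have hqz : q z ∈ Submodule.span ℂ (Set.range fun j => F j z) := by
      rw [heq]
      exact Submodule.mem_sup_right (mem_fiber.2 ⟨q, hq.1, rfl⟩)
    obtain ⟨x, hx⟩ := (Submodule.mem_span_range_iff_exists_fun ℂ).1 hqz
    have hLq : L (q z) = (N z).mulVec x := by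
      ext i
      simp [← hx, N, Matrix.mulVec, dotProduct, mul_comm]
    have hcx : ∀ j, c j z = δ z * x j := fun j => by
      simp only [c, hLq, Matrix.mulVec_mulVec, Matrix.adjugate_mul, Matrix.smul_mulVec,
        Matrix.one_mulVec, Pi.smul_apply, smul_eq_mul, δ]
    rw [← hx, Finset.smul_sum]
    refine Finset.sum_congr rfl fun j _ => ?_
    simp only [Pi.mul_apply, hcx, smul_smul, mul_assoc]
  obtain ⟨g₁, hg₁M, hg₁⟩ := hM₁.exists_sum (fun i => A.mul_mem hδ (hc (Sum.inl i)))
    fun i => (hf i).1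
  obtain ⟨g₂, hg₂M, hg₂⟩ := hM₂.exists_sum (fun i => A.mul_mem hδ (hc (Sum.inr i)))
    fun i => (hp i).1
  obtain ⟨g, hgM, hg⟩ := hM₂ _ (A.mul_mem hδ hδ) q hq.1
  have hsum : ∀ z, g z = g₁ z + g₂ z := fun z => by
    rw [hg, cramer, Fintype.sum_sum_type, hg₁, hg₂]
    rfl
  have hg₁g : g₁ = g - g₂ := RKHS.ext fun z => by simp [hsum]
  refine mem_fiber.2 ⟨g₁, ⟨hg₁M, hg₁g ▸ M₂.sub_mem hgM hg₂M⟩, ?_⟩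
  have hN₀ : N z₀ = 1 := by
    ext i j
    simp [N, hFv, hL, Matrix.one_apply, Pi.single_apply]
  have hδ₀ : δ z₀ = 1 := by simp [δ, hN₀]
  -- Here q(z₀) ∈ `fiber M₁ z₀` is used: it has no component along the complementary vectors, so
  -- `g₂` vanishes at `z₀`.
  have hLw : ∀ j, L (q z₀) (Sum.inr j) = 0 := by
    intro j
    have hw : q z₀ ∈ Submodule.span ℂ (Set.range (v ∘ Sum.inl)) := hv₁ ▸ hw₁
    have hle : Submodule.span ℂ (Set.range (v ∘ Sum.inl)) ≤ (LinearMap.proj (Sum.inr j) ∘ₗ L).ker :=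
      Submodule.span_le.2 (by rintro _ ⟨i, rfl⟩; simp [hL])
    exact hle hw
  have hg₂₀ : g₂ z₀ = 0 := by
    rw [hg₂]
    exact Finset.sum_eq_zero fun j _ => by simp [c, hN₀, hLw]
  have := hsum z₀
  rw [hg₂₀, add_zero, hg] at this
  rw [← this]
  simp [hδ₀]

end FiberDimension

/-! ### Analyticity and the dimension count. -/

section Analytic

variable {n : ℕ}

/-- The algebra `𝒪(Ω)` of analytic functions on `Ω`. -/
def analyticSubalgebra (Ω : Set (Fin n → ℂ)) : Subalgebra ℂ (Ω → ℂ) where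
  carrier := {f | IsAnalyticOn f}
  mul_mem' := by
    rintro f g ⟨F, hF, hf⟩ ⟨G, hG, hg⟩
    exact ⟨F * G, hF.mul hG, fun z => by simp [hf, hg]⟩
  add_mem' := by
    rintro f g ⟨F, hF, hf⟩ ⟨G, hG, hg⟩
    exact ⟨F + G, hF.add hG, fun z => by simp [hf, hg]⟩
  algebraMap_mem' c := ⟨fun _ => c, analyticOnNhd_const, fun z => rfl⟩

/-- If f * g = 0, then g vanishes near any point where f does not, hence everywhere by the identity
theorem. -/
theorem mul_ne_zero_of_mem_analyticSubalgebra {Ω : Set (Fin n → ℂ)} (hΩ : IsOpen Ω)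
    (hΩ' : IsPreconnected Ω) {f g : Ω → ℂ} (hf : f ∈ analyticSubalgebra Ω)
    (hg : g ∈ analyticSubalgebra Ω) (hf₀ : f ≠ 0) (hg₀ : g ≠ 0) : f * g ≠ 0 := by
  obtain ⟨F, hF, hFf⟩ := hf
  obtain ⟨G, hG, hGg⟩ := hg
  intro h
  obtain ⟨z, hz⟩ := Function.ne_iff.1 hf₀
  refine hg₀ (funext fun w => ?_)
  have hFz : ∀ᶠ y in nhds (z : Fin n → ℂ), F y ≠ 0 :=
    (hF z z.2).continuousAt.eventually_ne (by rwa [hFf])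
  have hGz : G =ᶠ[nhds (z : Fin n → ℂ)] 0 := by
    filter_upwards [hFz, hΩ.mem_nhds z.2] with y hy hyΩ
    have h1 := congrFun h ⟨y, hyΩ⟩
    rw [Pi.mul_apply, ← hFf, ← hGg] at h1
    exact (mul_eq_zero.1 h1).resolve_left hy
  have := hG.eqOn_zero_of_preconnected_of_eventuallyEq_zero hΩ' z.2 hGz w.2
  rw [← hGg, this]
  rfl

theorem fiberDimensionFormula_of_fiber_le {Ω : Set (Fin n → ℂ)} (hΩ : IsOpen Ω)
    (hΩ' : IsConnected Ω) {D E : Type*} [NormedAddCommGroup D] [InnerProductSpace ℂ D]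
    [FiniteDimensional ℂ D] [NormedAddCommGroup E] [InnerProductSpace ℂ E] [RKHS ℂ E Ω D]
    (hE : ∀ (f : E) (l : D →ₗ[ℂ] ℂ), IsAnalyticOn fun z => l (f z)) {A : Subalgebra ℂ (Ω → ℂ)}
    {M₁ M₂ : Submodule ℂ E} (hM₁ : IsInvariant A M₁) (hM₂ : IsInvariant A M₂)
    (h₁ : ∀ z, fiber M₁ z ≤ fiber (coeffSubmodule A M₁) z)
    (h₂ : ∀ z, fiber M₂ z ≤ fiber (coeffSubmodule A M₂) z) :
    FiberDimensionFormula M₁ M₂ := by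
  have : Nonempty Ω := hΩ'.nonempty.to_subtype
  have generic := exists_mem_forall_ne_zero_finrank_eq_fd (A := analyticSubalgebra Ω) hE
  obtain ⟨δ₁, hδ₁, hne₁, hfd₁⟩ := generic M₁
  obtain ⟨δ₂, hδ₂, hne₂, hfd₂⟩ := generic M₂
  obtain ⟨δ₃, hδ₃, hne₃, hfd₃⟩ := generic (M₁ ⊔ M₂).topologicalClosure
  obtain ⟨δ₄, hδ₄, hne₄, hfd₄⟩ := generic (M₁ ⊓ M₂)
  have hmul := fun {f g : Ω → ℂ} => mul_ne_zero_of_mem_analyticSubalgebra hΩ hΩ'.isPreconnected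
    (f := f) (g := g)
  have hne := hmul ((analyticSubalgebra Ω).mul_mem hδ₁ hδ₂)
    ((analyticSubalgebra Ω).mul_mem hδ₃ hδ₄) (hmul hδ₁ hδ₂ hne₁ hne₂) (hmul hδ₃ hδ₄ hne₃ hne₄)
  obtain ⟨z, hz⟩ := Function.ne_iff.1 hne
  simp only [Pi.mul_apply, Pi.zero_apply, ne_eq, mul_eq_zero, not_or] at hz
  have hinf : fiber (M₁ ⊓ M₂) z = fiber M₁ z ⊓ fiber M₂ z :=
    le_antisymm (le_inf (fiber_mono inf_le_left z) (fiber_mono inf_le_right z))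
      (fiber_inf_fiber_le hM₁ hM₂ (h₁ z) (h₂ z) fun y => by
        rw [← fiber_topologicalClosure_sup, ← fiber_topologicalClosure_sup, hfd₃ z hz.2.1]
        exact finrank_fiber_le_fd _ y)
  rw [FiberDimensionFormula, ← hfd₁ z hz.1.1, ← hfd₂ z hz.1.2, ← hfd₃ z hz.2.1, ← hfd₄ z hz.2.2,
    hinf, fiber_topologicalClosure_sup]
  exact Submodule.finrank_sup_add_finrank_inf_eq _ _

end Analytic
end FiberDim

/-- `H = H(K)` is an analytic functional Hilbert space on the domain `Ω ⊆ ℂⁿ` with reproducing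
kernel `K`, and `HD = H(K_D)` is the functional Hilbert space of `D`-valued functions with
reproducing kernel `K_D = K 1_D`. -/
theorem mainTheorem10 {n : ℕ} (Ω : Set (Fin n → ℂ)) (hΩ_open : IsOpen Ω) (hΩ_conn : IsConnected Ω)
    {H : Type*} [NormedAddCommGroup H] [InnerProductSpace ℂ H] [CompleteSpace H] [RKHS ℂ H Ω ℂ]
    (hH_analytic : ∀ f : H, FiberDim.IsAnalyticOn (f : Ω → ℂ))
    {D : Type*} [NormedAddCommGroup D] [InnerProductSpace ℂ D] [CompleteSpace D]
    [FiniteDimensional ℂ D]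
    {HD : Type*} [NormedAddCommGroup HD] [InnerProductSpace ℂ HD] [CompleteSpace HD]
    [RKHS ℂ HD Ω D]
    (hHD : RKHS.kernel HD = FiberDim.kernelD H D)
    (h_const : ∀ c : ℂ, ∃ f : H, ∀ z : Ω, f z = c)
    (h_coord : ∀ i : Fin n, (fun z : Ω => (z : Fin n → ℂ) i) ∈ FiberDim.multiplierAlgebra H) :
    (∀ M₁ M₂ : Submodule ℂ HD,
        IsClosed (M₁ : Set HD) → IsClosed (M₂ : Set HD) →
        FiberDim.IsInvariant (FiberDim.multiplierAlgebra H) M₁ →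
        FiberDim.IsInvariant (FiberDim.multiplierAlgebra H) M₂ →
        FiberDim.IsDenseIn (FiberDim.multiplierAlgebra H) M₁ →
        FiberDim.IsDenseIn (FiberDim.multiplierAlgebra H) M₂ →
        FiberDim.FiberDimensionFormula M₁ M₂) ∧
    (FiberDim.IsCompleteNevanlinnaPick (FiberDim.scalarKernel H) →
      ∀ M₁ M₂ : Submodule ℂ HD,
        IsClosed (M₁ : Set HD) → IsClosed (M₂ : Set HD) →
        FiberDim.IsInvariant (FiberDim.multiplierAlgebra H) M₁ →
        FiberDim.IsInvariant (FiberDim.multiplierAlgebra H) M₂ →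
        FiberDim.FiberDimensionFormula M₁ M₂) := by

  have hE : ∀ (f : HD) (l : D →ₗ[ℂ] ℂ), FiberDim.IsAnalyticOn fun z => l (f z) := by
    intro f l
    obtain ⟨g, hg⟩ := FiberDim.exists_coord hHD f
      ((InnerProductSpace.toDual ℂ D).symm l.toContinuousLinearMap)
    obtain ⟨F, hF, hFg⟩ := hH_analytic g
    refine ⟨F, hF, fun z => ?_⟩
    rw [hFg, hg, InnerProductSpace.toDual_symm_apply]
    rfl
  refine ⟨fun M₁ M₂ _ _ hM₁ hM₂ hd₁ hd₂ => ?_, fun hK M₁ M₂ hc₁ hc₂ hM₁ hM₂ => ?_⟩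
  · exact FiberDim.fiberDimensionFormula_of_fiber_le hΩ_open hΩ_conn hE hM₁ hM₂
      hd₁.fiber_le hd₂.fiber_le
  -- Closedness enters here, to provide the orthogonal projections onto `M₁` and `M₂`.
  · have := hc₁.completeSpace_coe
    have := hc₂.completeSpace_coe
    exact FiberDim.fiberDimensionFormula_of_fiber_le hΩ_open hΩ_conn hE hM₁ hM₂
      (hK.fiber_le M₁ hHD hM₁) (hK.fiber_le M₂ hHD hM₂)
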